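/- Let $\mathcal G$ be a connected, locally finite metric graph with countable vertex set and countable edge set, each edge $e$ being identified with an interval $[a_e,b_e]$ of finite positive length; loops and multiple edges are allowed. Let $d$ be the geodesic distance on $\mathcal G$ (the infimum of the lengths of finite paths) and let $\overline{\mathcal G}$ be the completion of $(\mathcal G,d)$. Fix a set $\partial\mathcal G$ of boundary vertices that contains every vertex of degree $1$, and put $\partial\overline{\mathcal G}=\overline{\mathcal G}\setminus(\mathcal G\setminus\partial\mathcal G)$. Assume that $\overline{\mathcal G}$ is compact and that $\partial\overline{\mathcal G}$ is totally disconnected. A continuous function $f:\overline{\mathcal G}\to\mathbb R$ is called harmonic if $f''=0$ on each edge and if, at every vertex $v\notin\partial\mathcal G$, the sum over the edge ends at $v$ of the derivatives of $f$ at $v$, taken in the direction pointing from $v$ into the edge, is $0$. Let $\mathbb H_1$ be the set of continuous functions $f:\overline{\mathcal G}\to\mathbb R$ that are absolutely continuous on each edge and satisfy $\sum_e\int_{a_e}^{b_e}(f_e')^2<\infty$, where $f_e$ denotes the restriction of $f$ to the edge $e$. If $\partial\overline{\mathcal G}$ is not a set of isolated points, that is, if some point of $\partial\overline{\mathcal G}$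 is a limit point of $\partial\overline{\mathcal G}$, then there is a continuous function $F:\partial\overline{\mathcal G}\to\mathbb R$ such that there is exactly one harmonic function $f:\overline{\mathcal G}\to\mathbb R$ with $f=F$ on $\partial\overline{\mathcal G}$, and this harmonic extension $f$ of $F$ is not in $\mathbb H_1$. -/

import Mathlib

open Set Filter Topology MeasureTheory

noncomputable section

/-- A connected, locally finite metric graph with vertex set `V` and edge set `E` (loops and
multiple edges allowed).  The edge `e` joins `src e` to `tgt e` and is identified with the interval
`[0, len e]`.  A set `bdry` of boundary vertices is chosen; it contains every vertex of degree one,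
a loop contributing two to the degree. -/
structure MetricGraph (V E : Type*) where
  src : E → V
  tgt : E → V
  len : E → ℝ
  len_pos : ∀ e, 0 < len e
  connected : ∀ v w : V, Relation.EqvGen (fun a b => ∃ e, src e = a ∧ tgt e = b) v w
  locallyFinite : ∀ v : V, {e | src e = v ∨ tgt e = v}.Finite
  bdry : Set V
  degree_one_mem_bdry : ∀ v : V, {e | src e = v}.ncard + {e | tgt e = v}.ncard = 1 → v ∈ bdry

namespace MetricGraph

variable {V E : Type*}

/-- The points of the metric graph: the vertices, and the points in the interiors of the edges. -/
inductive Point (G : MetricGraph V E) : Type _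
  | vertex (v : V) : Point G
  | inner (e : E) (t : ℝ) (ht : t ∈ Ioo 0 (G.len e)) : Point G

/-- The identification of `[0, len e]` with the closed edge `e`. Parameters outside of
`[0, len e]` are sent to the nearer endpoint. -/
def pt (G : MetricGraph V E) (e : E) (t : ℝ) : G.Point :=
  if h0 : 0 < t then
    if h1 : t < G.len e then Point.inner e t ⟨h0, h1⟩ else Point.vertex (G.tgt e)
  else Point.vertex (G.src e)

/-- `G.HasPath x y L`: there is a path of length `L` from `x` to `y`, that is, a finite
concatenation of segments, each of which is contained in a closed edge. -/
inductive HasPath (G : MetricGraph V E) : G.Point → G.Point → ℝ → Prop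
  | refl (x : G.Point) : HasPath G x x 0
  | step {x y z : G.Point} {L : ℝ} (e : E) (s t : ℝ) :
      HasPath G x y L → s ∈ Icc 0 (G.len e) → t ∈ Icc 0 (G.len e) →
      y = G.pt e s → z = G.pt e t → HasPath G x z (L + |t - s|)

variable (G : MetricGraph V E)

theorem HasPath.nonneg {G : MetricGraph V E} {x y : G.Point} {L : ℝ} (h : G.HasPath x y L) :
    0 ≤ L := by
  induction h with
  | refl => exact le_rfl
  | step e s t _ _ _ _ _ ih => positivity

theorem HasPath.trans {G : MetricGraph V E} {x y z : G.Point} {L M : ℝ} (h : G.HasPath x y L)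
    (h' : G.HasPath y z M) : G.HasPath x z (L + M) := by
  induction h' with
  | refl => simpa using h
  | step e s t _ hs ht hy hz ih =>
    rw [← add_assoc]
    exact HasPath.step e s t ih hs ht hy hz

theorem HasPath.symm {G : MetricGraph V E} {x y : G.Point} {L : ℝ} (h : G.HasPath x y L) :
    G.HasPath y x L := by
  induction h with
  | refl => exact HasPath.refl _
  | step e s t _ hs ht hy hz ih =>
    have h1 := HasPath.trans (HasPath.step e t s (HasPath.refl _) ht hs hz hy) ih
    rwa [zero_add, abs_sub_comm, add_comm] at h1

theorem pt_zero (e : E) : G.pt e 0 = Point.vertex (G.src e) := by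
  simp [pt]

theorem pt_len (e : E) : G.pt e (G.len e) = Point.vertex (G.tgt e) := by
  simp [pt, G.len_pos e]

theorem pt_inner (e : E) (t : ℝ) (ht : t ∈ Ioo 0 (G.len e)) : G.pt e t = Point.inner e t ht := by
  simp [pt, ht.1, ht.2]

theorem exists_hasPath_vertex (v w : V) :
    ∃ L, G.HasPath (Point.vertex v) (Point.vertex w) L := by
  induction G.connected v w with
  | rel a b h =>
    obtain ⟨e, rfl, rfl⟩ := h
    exact ⟨_, HasPath.step e 0 (G.len e) (HasPath.refl _) (left_mem_Icc.2 (G.len_pos e).le)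
      (right_mem_Icc.2 (G.len_pos e).le) (G.pt_zero e).symm (G.pt_len e).symm⟩
  | refl a => exact ⟨0, HasPath.refl _⟩
  | symm a b _ ih => exact ⟨_, ih.choose_spec.symm⟩
  | trans a b c _ _ ih1 ih2 => exact ⟨_, ih1.choose_spec.trans ih2.choose_spec⟩

theorem exists_hasPath_to_vertex (x : G.Point) : ∃ v L, G.HasPath x (Point.vertex v) L := by
  cases x with
  | vertex v => exact ⟨v, 0, HasPath.refl _⟩
  | inner e t ht =>
    exact ⟨G.src e, _, HasPath.step e t 0 (HasPath.refl _) (Ioo_subset_Icc_self ht)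
      (left_mem_Icc.2 (G.len_pos e).le) (G.pt_inner e t ht).symm (G.pt_zero e).symm⟩

theorem exists_hasPath (x y : G.Point) : ∃ L, G.HasPath x y L := by
  obtain ⟨v, L, h⟩ := G.exists_hasPath_to_vertex x
  obtain ⟨w, M, h'⟩ := G.exists_hasPath_to_vertex y
  obtain ⟨K, h''⟩ := G.exists_hasPath_vertex v w
  exact ⟨_, (h.trans h'').trans h'.symm⟩

theorem bddBelow_hasPath (x y : G.Point) : BddBelow {L | G.HasPath x y L} :=
  ⟨0, fun _ h => h.nonneg⟩

/-- The geodesic distance: the infimum of the lengths of the paths from `x` to `y`.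
(It separates points, since the graph is locally finite; this is not needed to form the
completion.) -/
instance : PseudoMetricSpace G.Point where
  dist x y := sInf {L | G.HasPath x y L}
  dist_self x := le_antisymm (csInf_le (G.bddBelow_hasPath x x) (HasPath.refl x))
    (le_csInf (G.exists_hasPath x x) fun _ h => h.nonneg)
  dist_comm x y := by
    congr 1
    ext L
    exact ⟨HasPath.symm, HasPath.symm⟩
  dist_triangle x y z := by
    refine le_of_forall_pos_lt_add fun ε hε => ?_
    obtain ⟨L, hL, hL'⟩ := Real.lt_sInf_add_pos (s := {L | G.HasPath x y L}) (G.exists_hasPath x y)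
      (half_pos hε)
    obtain ⟨M, hM, hM'⟩ := Real.lt_sInf_add_pos (s := {L | G.HasPath y z L})
      (G.exists_hasPath y z) (half_pos hε)
    have := csInf_le (G.bddBelow_hasPath x z) (HasPath.trans hL hM)
    linarith

/-- The metric completion `Ḡ` of the graph. -/
abbrev Compl : Type _ := UniformSpace.Completion G.Point

/-- The interior of the graph: all its points except the boundary vertices. -/
def interior : Set G.Point := {p | ∀ v ∈ G.bdry, p ≠ Point.vertex v}

/-- The boundary `∂Ḡ` of the completion: the complement in `Ḡ` of the interior of the graph. -/
def boundary : Set G.Compl := ((↑) '' G.interior : Set G.Compl)ᶜ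

variable {G}

/-- The component `f_e` of a function `f` on `Ḡ`; only its values on `[0, len e]` matter. -/
def component (f : G.Compl → ℝ) (e : E) (t : ℝ) : ℝ := f (G.pt e t : G.Compl)

/-- The derivative at the vertex `src e` of the component `f_e`, in the coordinate pointing from
the vertex into the edge. -/
def derivSrc (f : G.Compl → ℝ) (e : E) : ℝ :=
  derivWithin (component f e) (Icc 0 (G.len e)) 0

/-- The derivative at the vertex `tgt e` of the component `f_e`, in the coordinate pointing from
the vertex into the edge. -/
def derivTgt (f : G.Compl → ℝ) (e : E) : ℝ :=
  -derivWithin (component f e) (Icc 0 (G.len e)) (G.len e)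

/-- Harmonic functions on `Ḡ`: continuous, with vanishing second derivative on each edge, and such
that at each interior vertex the sum of the derivatives along the incident edge ends is zero. -/
structure IsHarmonic (f : G.Compl → ℝ) : Prop where
  continuous : Continuous f
  contDiffOn : ∀ e, ContDiffOn ℝ 2 (component f e) (Icc 0 (G.len e))
  second_deriv : ∀ e, ∀ t ∈ Icc 0 (G.len e),
    iteratedDerivWithin 2 (component f e) (Icc 0 (G.len e)) t = 0
  vertex_condition : ∀ v ∉ G.bdry,
    (∑ᶠ e ∈ {e | G.src e = v}, derivSrc f e) + (∑ᶠ e ∈ {e | G.tgt e = v}, derivTgt f e) = 0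

/-- `f` is a harmonic function on `Ḡ` with boundary values `F`. -/
def IsHarmonicExtension (F : C(G.boundary, ℝ)) (f : G.Compl → ℝ) : Prop :=
  IsHarmonic f ∧ ∀ x : G.boundary, f x = F x

/-- Membership in the energy space `ℍ₁`: `f` is continuous on `Ḡ`, absolutely continuous on the
edges, and `f'` is square integrable on the graph. -/
structure MemH1 (f : G.Compl → ℝ) : Prop where
  continuous : Continuous f
  absolutelyContinuous : ∀ e, AbsolutelyContinuousOnInterval (component f e) 0 (G.len e)
  finite_energy :
    ∑' e, ∫⁻ t in Ioo 0 (G.len e), ENNReal.ofReal (deriv (component f e) t ^ 2) < ⊤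

end MetricGraph

end

namespace MetricGraph

variable {V E : Type*} {G : MetricGraph V E}

/-! ### Edges and Lipschitz functions -/

/-! Finite energy forces Hölder continuity of exponent 1/2: an edgewise affine `u` of energy at most
`C` satisfies `|u x - u y| ≤ l * dist x y + C / l` for all `l > 0` (`abs_sub_le_of_energy_le`). So
it is enough to find boundary values whose harmonic extension violates this at a limit point `x₀` of
the boundary.

Choose boundary points `y k ≠ x₀` within `16 ^ (-k)` of `x₀`, and harmonic `h k` with values in `[0,
1]`, equal to `1` at `x₀` and `0` at `y k`. The sum `f = ∑ 2 ^ (-k) * h k` is harmonic by uniform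
convergence. Since every `h j` is maximal at `x₀`, nothing cancels and `f x₀ - f (y k) ≥ 2 ^ (-k)`,
too much for finite energy.

The `h k` come from `exists_isHarmonic_separating`: a clopen subset of the boundary separates the
two points, its indicator extends with finite energy (`exists_edgeAffine_indicator`), and minimising
the energy makes the extension harmonic (`exists_isHarmonic`). The same modulus of continuity
supplies the compactness for the minimisation. Uniqueness is the maximum principle
(`IsHarmonic.le_of_le_boundary`). -/

theorem dist_le_of_hasPath {x y : G.Point} {L : ℝ} (h : G.HasPath x y L) : dist x y ≤ L :=
  csInf_le (G.bddBelow_hasPath x y) h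

theorem dist_pt_le (e : E) {s t : ℝ} (hs : s ∈ Icc 0 (G.len e)) (ht : t ∈ Icc 0 (G.len e)) :
    dist (G.pt e s) (G.pt e t) ≤ |t - s| := by
  have := dist_le_of_hasPath (HasPath.step e s t (HasPath.refl (G.pt e s)) hs ht rfl rfl)
  simpa using this

theorem zero_mem_Icc (e : E) : (0 : ℝ) ∈ Icc 0 (G.len e) := left_mem_Icc.2 (G.len_pos e).le

theorem len_mem_Icc (e : E) : G.len e ∈ Icc 0 (G.len e) := right_mem_Icc.2 (G.len_pos e).le

theorem continuousOn_pt (e : E) : ContinuousOn (G.pt e) (Icc 0 (G.len e)) := by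
  have : LipschitzOnWith 1 (G.pt e) (Icc 0 (G.len e)) := by
    refine LipschitzOnWith.of_dist_le_mul fun s hs t ht => ?_
    rw [NNReal.coe_one, one_mul, dist_comm s t, Real.dist_eq]
    exact dist_pt_le e hs ht
  exact this.continuousOn

theorem isCompact_edge (e : E) : IsCompact (G.pt e '' Icc 0 (G.len e)) :=
  isCompact_Icc.image_of_continuousOn (continuousOn_pt e)

/-- A function which is `K`-Lipschitz along each edge satisfies `|g x - g y| ≤ K * dist x y`. -/
theorem abs_sub_le_of_edges {g : G.Point → ℝ} {K : ℝ} (hK : 0 ≤ K)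
    (hg : ∀ e, ∀ s ∈ Icc 0 (G.len e), ∀ t ∈ Icc 0 (G.len e),
      |g (G.pt e t) - g (G.pt e s)| ≤ K * |t - s|) (x y : G.Point) :
    |g x - g y| ≤ K * dist x y := by
  have key : ∀ x y L, G.HasPath x y L → |g y - g x| ≤ K * L := by
    intro x y L h
    induction h with
    | refl => simp
    | step e s t _ hs ht hy hz ih =>
      subst hy hz
      have := abs_sub_le (g (G.pt e t)) (g (G.pt e s)) (g x)
      have := hg e s hs t ht
      rw [mul_add]
      linarith
  refine le_of_forall_pos_le_add fun ε hε => ?_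
  have hδ : 0 < ε / (K + 1) := by positivity
  obtain ⟨L, hL, hL'⟩ := Real.lt_sInf_add_pos (s := {L | G.HasPath x y L}) (G.exists_hasPath x y) hδ
  have h1 := key x y L hL
  have h2 : L ≤ dist x y + ε / (K + 1) := hL'.le
  have h3 : K * (ε / (K + 1)) ≤ ε := by
    rw [mul_div_assoc', div_le_iff₀ (by positivity)]
    nlinarith
  rw [abs_sub_comm]
  nlinarith [mul_le_mul_of_nonneg_left h2 hK]

/-- A function which is Lipschitz along the edges extends continuously to the completion. -/
theorem exists_extension {g : G.Point → ℝ} {K : ℝ} (hK : 0 ≤ K)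
    (hg : ∀ e, ∀ s ∈ Icc 0 (G.len e), ∀ t ∈ Icc 0 (G.len e),
      |g (G.pt e t) - g (G.pt e s)| ≤ K * |t - s|) :
    ∃ f : G.Compl → ℝ, Continuous f ∧ ∀ p : G.Point, f p = g p := by
  have hl : LipschitzWith ⟨K, hK⟩ g := LipschitzWith.of_dist_le_mul fun x y => by
    rw [Real.dist_eq]
    exact abs_sub_le_of_edges hK hg x y
  exact ⟨UniformSpace.Completion.extension g, UniformSpace.Completion.continuous_extension,
    fun p => UniformSpace.Completion.extension_coe hl.uniformContinuous p⟩

/-- A continuous function on the completion which vanishes at the points of the graph off a compact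
set `K` vanishes off `K`. -/
theorem mem_image_of_ne_zero {f : G.Compl → ℝ} (hf : Continuous f) {K : Set G.Point}
    (hK : IsCompact K) (h : ∀ p : G.Point, f p ≠ 0 → p ∈ K) {x : G.Compl} (hx : f x ≠ 0) :
    x ∈ ((↑) '' K : Set G.Compl) := by
  have hcl : IsClosed ((↑) '' K : Set G.Compl) :=
    (hK.image (UniformSpace.Completion.continuous_coe _)).isClosed
  by_contra hxK
  have hopen : IsOpen ({x | f x ≠ 0} ∩ ((↑) '' K : Set G.Compl)ᶜ) :=
    (isOpen_ne_fun hf continuous_const).inter hcl.isOpen_compl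
  obtain ⟨p, hp1, hp2⟩ := (UniformSpace.Completion.denseRange_coe (α := G.Point)).exists_mem_open
    hopen ⟨x, hx, hxK⟩
  exact hp2 ⟨p, h p hp1, rfl⟩

/-! ### Functions that are affine on edges -/

/-- A vertex, seen in the completion of the graph. -/
noncomputable def vtx (G : MetricGraph V E) (v : V) : G.Compl := ((Point.vertex v : G.Point) : G.Compl)

/-- The increment of a function along an edge. -/
noncomputable def increment (f : G.Compl → ℝ) (e : E) : ℝ := f (G.vtx (G.tgt e)) - f (G.vtx (G.src e))

/-- The function is affine on each edge. -/
def EdgeAffine (f : G.Compl → ℝ) : Prop :=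
  ∀ e, ∀ t ∈ Icc 0 (G.len e), f (G.pt e t) = f (G.vtx (G.src e)) + t * (increment f e / G.len e)

/-- The energy of a function that is affine on each edge. -/
noncomputable def energy (f : G.Compl → ℝ) : ENNReal :=
  ∑' e, ENNReal.ofReal (increment f e ^ 2 / G.len e)

/-- The affine interpolation of a function on the vertices. -/
noncomputable def interpolate (G : MetricGraph V E) (w : V → ℝ) : G.Point → ℝ
  | .vertex v => w v
  | .inner e t _ => w (G.src e) + t * ((w (G.tgt e) - w (G.src e)) / G.len e)

theorem interpolate_pt (w : V → ℝ) (e : E) {t : ℝ} (ht : t ∈ Icc 0 (G.len e)) :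
    G.interpolate w (G.pt e t) = w (G.src e) + t * ((w (G.tgt e) - w (G.src e)) / G.len e) := by
  rcases eq_or_lt_of_le ht.1 with h0 | h0
  · rw [← h0, pt_zero]; simp [interpolate]
  rcases eq_or_lt_of_le ht.2 with h1 | h1
  · rw [h1, pt_len, mul_div_cancel₀ _ (G.len_pos e).ne']; simp [interpolate]
  · rw [pt_inner G e t ⟨h0, h1⟩]; rfl

/-- If a function on the vertices has nonzero increment on finitely many edges only, then its affine
interpolation extends continuously to the completion. -/
theorem exists_edgeAffine (w : V → ℝ) (hw : {e | w (G.tgt e) ≠ w (G.src e)}.Finite) :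
    ∃ f : G.Compl → ℝ, Continuous f ∧ EdgeAffine f ∧ (∀ v, f (G.vtx v) = w v) ∧
      ∀ p : G.Point, f p = G.interpolate w p := by
  set K : ℝ := ∑ e ∈ hw.toFinset, |(w (G.tgt e) - w (G.src e)) / G.len e|
  have hK : 0 ≤ K := Finset.sum_nonneg fun _ _ => abs_nonneg _
  have hslope : ∀ e, |(w (G.tgt e) - w (G.src e)) / G.len e| ≤ K := by
    intro e
    by_cases he : w (G.tgt e) = w (G.src e)
    · simpa [he] using hK
    · exact Finset.single_le_sum (f := fun e => |(w (G.tgt e) - w (G.src e)) / G.len e|)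
        (fun _ _ => abs_nonneg _) (hw.mem_toFinset.2 he)
  obtain ⟨f, hf, hfg⟩ := exists_extension (G := G) (g := G.interpolate w) hK (by
    intro e s hs t ht
    rw [interpolate_pt w e hs, interpolate_pt w e ht, add_sub_add_left_eq_sub, ← sub_mul, abs_mul,
      mul_comm]
    exact mul_le_mul_of_nonneg_right (hslope e) (abs_nonneg _))
  refine ⟨f, hf, fun e t ht => ?_, fun v => hfg _, hfg⟩
  rw [hfg, interpolate_pt w e ht, increment, vtx, vtx, hfg, hfg]
  rfl

open Classical in
/-- The indicator function of a vertex. -/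
noncomputable def hat (v w : V) : ℝ := if w = v then 1 else 0

theorem hat_self (v : V) : hat v v = 1 := by simp [hat]

theorem hat_of_ne {v w : V} (h : w ≠ v) : hat v w = 0 := by simp [hat, h]

/-- The edges at a vertex. -/
noncomputable def star (G : MetricGraph V E) (v : V) : Finset E := (G.locallyFinite v).toFinset

theorem mem_star {v : V} {e : E} : e ∈ G.star v ↔ G.src e = v ∨ G.tgt e = v := by
  simp [star]

theorem hat_tgt_eq_of_notMem_star {v : V} {e : E} (h : e ∉ G.star v) :
    hat v (G.src e) = 0 ∧ hat v (G.tgt e) = 0 := by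
  rw [mem_star, not_or] at h
  exact ⟨hat_of_ne h.1, hat_of_ne h.2⟩

theorem vertex_mem_interior {v : V} (hv : v ∉ G.bdry) : Point.vertex v ∈ G.interior := by
  rintro w hw h
  rw [Point.vertex.injEq] at h
  exact hv (h ▸ hw)

theorem inner_mem_interior (e : E) (t : ℝ) (ht : t ∈ Ioo 0 (G.len e)) :
    Point.inner e t ht ∈ G.interior := by
  rintro w _ h
  cases h

theorem notMem_boundary {p : G.Point} (hp : p ∈ G.interior) : (p : G.Compl) ∉ G.boundary :=
  fun h => h ⟨p, hp, rfl⟩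

theorem exists_of_notMem_boundary {x : G.Compl} (hx : x ∉ G.boundary) :
    ∃ p ∈ G.interior, (p : G.Compl) = x := by
  simpa [boundary] using hx

/-- The hat function of an interior vertex: a compactly supported perturbation. -/
theorem exists_hat (v : V) (hv : v ∉ G.bdry) :
    ∃ h : G.Compl → ℝ, Continuous h ∧ EdgeAffine h ∧ (∀ w, h (G.vtx w) = hat v w) ∧
      (∀ x ∈ G.boundary, h x = 0) := by
  obtain ⟨h, hc, ha, hv', hp⟩ := exists_edgeAffine (G := G) (hat v)
    ((G.star v).finite_toSet.subset fun e he => by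
      by_contra hn
      obtain ⟨h1, h2⟩ := hat_tgt_eq_of_notMem_star hn
      exact he (h2.trans h1.symm))
  refine ⟨h, hc, ha, hv', fun x hx => ?_⟩
  by_contra hne
  -- The singleton is needed when no edge is incident to `v`.
  have hK : IsCompact ({Point.vertex v} ∪ ⋃ e ∈ G.star v, G.pt e '' Icc 0 (G.len e)) :=
    isCompact_singleton.union ((G.star v).isCompact_biUnion fun e _ => isCompact_edge e)
  obtain ⟨p, -, rfl⟩ := mem_image_of_ne_zero hc hK (fun p hp0 => by
    cases p with
    | vertex w =>
      left
      by_contra hw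
      have hw' : w ≠ v := fun h => hw (by rw [h]; rfl)
      exact hp0 ((hv' w).trans (hat_of_ne hw'))
    | inner e t ht =>
      right
      have he : e ∈ G.star v := by
        by_contra hn
        obtain ⟨h1, h2⟩ := hat_tgt_eq_of_notMem_star hn
        rw [hp] at hp0
        simp [interpolate, h1, h2] at hp0
      exact mem_biUnion he ⟨t, Ioo_subset_Icc_self ht, pt_inner G e t ht⟩) hne
  cases p with
  | vertex w =>
    have : w = v := by
      by_contra hw
      exact hne ((hv' w).trans (hat_of_ne hw))
    subst this
    exact notMem_boundary (vertex_mem_interior hv) hx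
  | inner e t ht => exact notMem_boundary (inner_mem_interior e t ht) hx

open Classical in
/-- The tent function on an edge. -/
noncomputable def tent (G : MetricGraph V E) (e : E) : G.Point → ℝ
  | .vertex _ => 0
  | .inner e' t _ => if e' = e then min t (G.len e - t) else 0

theorem tent_pt_of_ne {e e' : E} (h : e' ≠ e) (t : ℝ) : G.tent e (G.pt e' t) = 0 := by
  unfold pt
  split_ifs <;> simp [tent, h]

theorem tent_pt (e : E) {t : ℝ} (ht : t ∈ Icc 0 (G.len e)) :
    G.tent e (G.pt e t) = min t (G.len e - t) := by
  rcases eq_or_lt_of_le ht.1 with h0 | h0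
  · rw [← h0, pt_zero]; simp [tent, (G.len_pos e).le]
  rcases eq_or_lt_of_le ht.2 with h1 | h1
  · rw [h1, pt_len]; simp [tent, (G.len_pos e).le]
  · rw [pt_inner G e t ⟨h0, h1⟩]; simp [tent]

theorem exists_tent (e : E) :
    ∃ h : G.Compl → ℝ, Continuous h ∧ (∀ p : G.Point, h p = G.tent e p) ∧
      (∀ x ∈ G.boundary, h x = 0) := by
  obtain ⟨h, hc, hp⟩ := exists_extension (G := G) (g := G.tent e) zero_le_one (by
    intro e' s hs t ht
    by_cases he : e' = e
    · subst he
      rw [tent_pt e' hs, tent_pt e' ht, one_mul]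
      have := abs_min_sub_min_le_max t (G.len e' - t) s (G.len e' - s)
      refine this.trans (max_le le_rfl ?_)
      rw [show G.len e' - t - (G.len e' - s) = -(t - s) by ring, abs_neg]
    · rw [tent_pt_of_ne he, tent_pt_of_ne he]; simp)
  refine ⟨h, hc, hp, fun x hx => ?_⟩
  by_contra hne
  obtain ⟨p, -, rfl⟩ := mem_image_of_ne_zero hc (isCompact_edge e) (fun p hp0 => by
    rw [hp] at hp0
    cases p with
    | vertex w => exact absurd rfl hp0
    | inner e' t ht =>
      by_cases he : e' = e
      · subst he
        exact ⟨t, Ioo_subset_Icc_self ht, pt_inner G e' t ht⟩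
      · simp [tent, he] at hp0) hne
  cases p with
  | vertex w => exact hne (hp _)
  | inner e t ht => exact notMem_boundary (inner_mem_interior e t ht) hx

/-- Each interior point of the graph has a neighbourhood that is disjoint from the boundary, and
meets finitely many edges only. -/
theorem exists_bump {p : G.Point} (hp : p ∈ G.interior) :
    ∃ (h : G.Compl → ℝ) (S : Finset E), Continuous h ∧ h p ≠ 0 ∧ (∀ x ∈ G.boundary, h x = 0) ∧
      (∀ v ∈ G.bdry, h (G.vtx v) = 0) ∧
      ∀ e ∉ S, ∀ t ∈ Icc 0 (G.len e), h (G.pt e t) = 0 := by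
  cases p with
  | vertex v =>
    have hv : v ∉ G.bdry := fun h => hp v h rfl
    obtain ⟨h, hc, ha, hw, hb⟩ := exists_hat (G := G) v hv
    refine ⟨h, G.star v, hc, ?_, hb, fun w hwb => ?_, fun e he t ht => ?_⟩
    · change h (G.vtx v) ≠ 0
      rw [hw, hat_self]
      exact one_ne_zero
    · rw [hw]
      exact hat_of_ne fun h => hv (h ▸ hwb)
    · obtain ⟨h1, h2⟩ := hat_tgt_eq_of_notMem_star he
      rw [ha e t ht, increment, hw, hw, h1, h2]
      simp
  | inner e t ht =>
    obtain ⟨h, hc, hh, hb⟩ := exists_tent (G := G) e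
    refine ⟨h, {e}, hc, ?_, hb, fun w hwb => hh _, fun e' he' t ht => ?_⟩
    · rw [hh]
      have h1 : 0 < t := ht.1
      have h2 : 0 < G.len e - t := sub_pos.2 ht.2
      simp only [tent, if_true]
      exact (lt_min h1 h2).ne'
    · rw [hh, tent_pt_of_ne (by simpa using he')]

/-- Not immediate from the definition: a boundary vertex might a priori have the same image in the
completion as an interior point. The bump functions exclude this. -/
theorem vtx_mem_boundary {v : V} (hv : v ∈ G.bdry) : G.vtx v ∈ G.boundary := by
  by_contra hn
  obtain ⟨p, hp, hpv⟩ := exists_of_notMem_boundary hn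
  obtain ⟨h, S, -, hne, -, hb, -⟩ := exists_bump hp
  rw [hpv] at hne
  exact hne (hb v hv)

theorem isClosed_boundary : IsClosed G.boundary := by
  rw [← isOpen_compl_iff, isOpen_iff_mem_nhds]
  intro x hx
  obtain ⟨p, hp, rfl⟩ := exists_of_notMem_boundary hx
  obtain ⟨h, S, hc, hne, hb, -, -⟩ := exists_bump hp
  exact mem_of_superset ((isOpen_ne_fun hc continuous_const).mem_nhds hne)
    fun y hy hyb => hy (hb y hyb)

/-- A compact subset of the completion which is disjoint from the boundary meets finitely many
edges only. -/
theorem exists_finset_edges {K : Set G.Compl} (hK : IsCompact K) (hKb : Disjoint K G.boundary) :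
    ∃ S : Finset E, ∀ e ∉ S, ∀ t ∈ Icc 0 (G.len e), (G.pt e t : G.Compl) ∉ K := by
  classical
  refine hK.induction_on (p := fun K => ∃ S : Finset E, ∀ e ∉ S, ∀ t ∈ Icc 0 (G.len e),
    (G.pt e t : G.Compl) ∉ K) ⟨∅, by simp⟩ ?_ ?_ ?_
  · rintro s t hst ⟨S, hS⟩
    exact ⟨S, fun e he r hr h => hS e he r hr (hst h)⟩
  · rintro s t ⟨S, hS⟩ ⟨T, hT⟩
    refine ⟨S ∪ T, fun e he r hr h => ?_⟩
    rw [Finset.notMem_union] at he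
    exact h.elim (hS e he.1 r hr) (hT e he.2 r hr)
  · intro x hx
    obtain ⟨p, hp, rfl⟩ := exists_of_notMem_boundary (disjoint_left.1 hKb hx)
    obtain ⟨h, S, hc, hne, -, -, hS⟩ := exists_bump hp
    exact ⟨{y | h y ≠ 0}, mem_nhdsWithin_of_mem_nhds
      ((isOpen_ne_fun hc continuous_const).mem_nhds hne), S, fun e he t ht h0 => h0 (hS e he t ht)⟩

/-! ### Oscillation of functions of finite energy -/

theorem volume_Ioc_diff_toReal_le (J : Set ℝ) {p q : ℝ} (h : p ≤ q) :
    (volume (Ioc p q \ J)).toReal ≤ q - p := by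
  refine ENNReal.toReal_le_of_le_ofReal (sub_nonneg.2 h) ?_
  exact (measure_mono sdiff_subset).trans_eq Real.volume_Ioc

theorem volume_Ioc_diff_ne_top (J : Set ℝ) (p q : ℝ) : volume (Ioc p q \ J) ≠ ⊤ :=
  measure_ne_top_of_subset sdiff_subset (by simp [Real.volume_Ioc])

/-- A function that is affine on edges and has energy at most `C` oscillates by at most
`l * dist x y + C / l`, for each `l > 0`.  The values taken on the edges of slope larger than `l`
fill a set `J` of measure at most `C / l`, and the function becomes `l`-Lipschitz once the values
in `J` are collapsed. -/
theorem sub_le_of_energy_le [Countable E] {u : G.Compl → ℝ} (ha : EdgeAffine u) {C : ℝ} (hC : 0 < C)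
    (hE : energy u ≤ ENNReal.ofReal C) {l : ℝ} (hl : 0 < l) (x y : G.Point) :
    u y - u x ≤ l * dist x y + C / l := by
  set J : Set ℝ := ⋃ e, {r | l * G.len e < |increment u e| ∧
    r ∈ uIcc (u (G.vtx (G.src e))) (u (G.vtx (G.tgt e)))}
  have hJvol : volume J ≤ ENNReal.ofReal (C / l) := by
    calc volume J ≤ ∑' e, volume {r | l * G.len e < |increment u e| ∧
          r ∈ uIcc (u (G.vtx (G.src e))) (u (G.vtx (G.tgt e)))} := measure_iUnion_le _
      _ ≤ ∑' e, ENNReal.ofReal (increment u e ^ 2 / G.len e) * ENNReal.ofReal (1 / l) := by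
        refine ENNReal.tsum_le_tsum fun e => ?_
        -- A steep edge takes values in an interval of length `|increment u e|`, and `l * len e <
        -- |increment u e|` bounds this by `increment u e ^ 2 / (l * len e)`.
        by_cases hs : l * G.len e < |increment u e|
        · simp only [hs, true_and, ofPred_mem_eq, Real.volume_interval]
          rw [← ENNReal.ofReal_mul (div_nonneg (sq_nonneg _) (G.len_pos e).le)]
          refine ENNReal.ofReal_le_ofReal ?_
          have hlen := G.len_pos e
          change |increment u e| ≤ _
          rw [div_mul_div_comm, mul_one, le_div_iff₀ (by positivity), ← sq_abs (increment u e), sq]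
          exact mul_le_mul_of_nonneg_left (by linarith) (abs_nonneg _)
        · simp [hs]
      _ = energy u * ENNReal.ofReal (1 / l) := ENNReal.tsum_mul_right
      _ ≤ ENNReal.ofReal C * ENNReal.ofReal (1 / l) := by gcongr
      _ = ENNReal.ofReal (C / l) := by
        rw [← ENNReal.ofReal_mul hC.le, mul_one_div]
  set a := u x with hadef
  -- `T ∘ u` is constant along steep edges and `l`-Lipschitz along the others. A path may therefore
  -- repeat edges, which would spoil a direct Cauchy–Schwarz estimate. For `s ≤ a` the interval is
  -- empty and `T s = 0`, harmless for an upper bound on `u y - a`.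
  set T : ℝ → ℝ := fun s => (volume (Ioc a s \ J)).toReal with hT
  have hmono : ∀ p q, p ≤ q → T p ≤ T q := fun p q h =>
    ENNReal.toReal_mono (volume_Ioc_diff_ne_top _ _ _)
      (measure_mono (sdiff_subset_sdiff_left (Ioc_subset_Ioc_right h)))
  have hadd : ∀ p q, T q ≤ T p + (volume (Ioc p q \ J)).toReal := by
    intro p q
    rw [hT, ← ENNReal.toReal_add (volume_Ioc_diff_ne_top _ _ _) (volume_Ioc_diff_ne_top _ _ _)]
    refine ENNReal.toReal_mono (ENNReal.add_ne_top.2 ⟨volume_Ioc_diff_ne_top _ _ _,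
      volume_Ioc_diff_ne_top _ _ _⟩) ((measure_mono ?_).trans (measure_union_le _ _))
    rw [← union_sdiff_distrib]
    exact sdiff_subset_sdiff_left Ioc_subset_Ioc_union_Ioc
  have hedge : ∀ e, ∀ s ∈ Icc 0 (G.len e), ∀ t ∈ Icc 0 (G.len e),
      u (G.pt e s) ≤ u (G.pt e t) → |T (u (G.pt e t)) - T (u (G.pt e s))| ≤ l * |t - s| := by
    intro e s hs t ht hst
    have hlen := G.len_pos e
    rw [abs_of_nonneg (sub_nonneg.2 (hmono _ _ hst))]
    have h1 := hadd (u (G.pt e s)) (u (G.pt e t))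
    by_cases hsteep : l * G.len e < |increment u e|
    · have hmem : ∀ r ∈ Icc 0 (G.len e),
          u (G.pt e r) ∈ uIcc (u (G.vtx (G.src e))) (u (G.vtx (G.tgt e))) := by
        intro r hr
        rw [← segment_eq_uIcc, segment_eq_image_lineMap]
        refine ⟨r / G.len e, ⟨div_nonneg hr.1 hlen.le, (div_le_one hlen).2 hr.2⟩, ?_⟩
        rw [ha e r hr, AffineMap.lineMap_apply, increment]
        simp only [vsub_eq_sub, smul_eq_mul, vadd_eq_add]
        ring
      have hempty : Ioc (u (G.pt e s)) (u (G.pt e t)) \ J = ∅ := by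
        rw [sdiff_eq_empty]
        intro r hr
        exact mem_iUnion.2 ⟨e, hsteep, ordConnected_uIcc.out (hmem s hs) (hmem t ht)
          (Ioc_subset_Icc_self hr)⟩
      rw [hempty, measure_empty, ENNReal.toReal_zero] at h1
      have : 0 ≤ l * |t - s| := by positivity
      linarith
    · have h2 := volume_Ioc_diff_toReal_le J hst
      have h3 : u (G.pt e t) - u (G.pt e s) ≤ l * |t - s| := by
        rw [ha e s hs, ha e t ht, add_sub_add_left_eq_sub, ← sub_mul]
        refine (le_abs_self _).trans ?_
        rw [abs_mul, mul_comm, abs_div, abs_of_pos hlen]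
        exact mul_le_mul_of_nonneg_right ((div_le_iff₀ hlen).2 (not_lt.1 hsteep)) (abs_nonneg _)
      linarith
  have hlip := abs_sub_le_of_edges (G := G) (g := fun p => T (u p)) hl.le (by
    intro e s hs t ht
    rcases le_total (u (G.pt e s)) (u (G.pt e t)) with h | h
    · exact hedge e s hs t ht h
    · rw [abs_sub_comm, abs_sub_comm t s]
      exact hedge e t ht s hs h) x y
  have hTx : T (u x) = 0 := by simp [hT, hadef]
  have hCl : 0 < C / l := div_pos hC hl
  have hfin : u y - a ≤ T (u y) + C / l := by
    rcases le_total (u y) a with h | h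
    · have : 0 ≤ T (u y) := ENNReal.toReal_nonneg
      linarith
    · have h1 : ENNReal.ofReal (u y - a) ≤ ENNReal.ofReal (T (u y) + C / l) := by
        rw [← Real.volume_Ioc, ENNReal.ofReal_add ENNReal.toReal_nonneg hCl.le,
          ENNReal.ofReal_toReal (volume_Ioc_diff_ne_top _ _ _)]
        calc volume (Ioc a (u y)) ≤ volume ((Ioc a (u y) \ J) ∪ J) :=
              measure_mono (by rw [sdiff_union_self]; exact subset_union_left)
          _ ≤ _ := (measure_union_le _ _).trans (by gcongr)
      exact (ENNReal.ofReal_le_ofReal_iff (by positivity)).1 h1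
  simp only [hTx, zero_sub, abs_neg] at hlip
  have := le_abs_self (T (u y))
  linarith

/-- Optimising over `l` would give `2 * √(C * dist x y)`. Leaving `l` free avoids treating distance
zero separately. -/
theorem abs_sub_le_of_energy_le [Countable E] {u : G.Compl → ℝ} (hc : Continuous u)
    (ha : EdgeAffine u) {C : ℝ} (hC : 0 < C) (hE : energy u ≤ ENNReal.ofReal C) {l : ℝ} (hl : 0 < l)
    (x y : G.Compl) : |u x - u y| ≤ l * dist x y + C / l := by
  refine UniformSpace.Completion.induction_on₂ x y ?_ fun p q => ?_
  · exact isClosed_le (by fun_prop) (by fun_prop)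
  · rw [UniformSpace.Completion.dist_eq, abs_sub_le_iff]
    refine ⟨?_, sub_le_of_energy_le ha hC hE hl p q⟩
    rw [dist_comm]
    exact sub_le_of_energy_le ha hC hE hl q p

/-! ### Harmonic functions as edgewise affine functions -/

/-- The discrete form of the vertex condition. -/
def Kirchhoff (f : G.Compl → ℝ) (v : V) : Prop :=
  ∑ e ∈ G.star v, (hat v (G.tgt e) - hat v (G.src e)) * (increment f e / G.len e) = 0

theorem affine_of_second_deriv_eq_zero {g : ℝ → ℝ} {L : ℝ} (hL : 0 < L)
    (hg : ContDiffOn ℝ 2 g (Icc 0 L))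
    (h2 : ∀ t ∈ Icc 0 L, iteratedDerivWithin 2 g (Icc 0 L) t = 0) :
    ∀ t ∈ Icc 0 L, g t = g 0 + t * ((g L - g 0) / L) := by
  have huniq : UniqueDiffOn ℝ (Icc 0 L) := uniqueDiffOn_Icc hL
  have hd : DifferentiableOn ℝ (derivWithin g (Icc 0 L)) (Icc 0 L) :=
    (hg.derivWithin (m := 1) huniq (by norm_num)).differentiableOn one_ne_zero
  have hconst : ∀ t ∈ Icc 0 L, derivWithin g (Icc 0 L) t = derivWithin g (Icc 0 L) 0 := by
    refine constant_of_derivWithin_zero hd fun t ht => ?_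
    have h1 : iteratedDerivWithin 1 g (Icc 0 L) = derivWithin g (Icc 0 L) := by
      ext s
      rw [iteratedDerivWithin_one]
    have := h2 t (Ico_subset_Icc_self ht)
    rwa [iteratedDerivWithin_succ, h1] at this
  set c := derivWithin g (Icc 0 L) 0
  have hg1 : DifferentiableOn ℝ g (Icc 0 L) := hg.differentiableOn two_ne_zero
  have haff : ∀ t ∈ Icc 0 L, g t - t * c = g 0 - 0 * c := by
    refine constant_of_derivWithin_zero (f := fun t => g t - t * c)
      (hg1.sub (by fun_prop)) fun t ht => ?_
    have ht' := Ico_subset_Icc_self ht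
    have h1 : HasDerivWithinAt g c (Icc 0 L) t := by
      have := (hg1 t ht').hasDerivWithinAt
      rwa [hconst t ht'] at this
    have h3 := (h1.sub ((hasDerivWithinAt_id t (Icc 0 L)).mul_const c)).derivWithin (huniq t ht')
    rw [one_mul, sub_self] at h3
    exact h3
  intro t ht
  have h1 := haff t ht
  have h3 := haff L (right_mem_Icc.2 hL.le)
  have h4 : (g L - g 0) / L = c := by
    rw [div_eq_iff hL.ne']
    linarith
  rw [h4]
  linarith

theorem hasDerivWithinAt_component {f : G.Compl → ℝ} (ha : EdgeAffine f) (e : E) {t : ℝ}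
    (ht : t ∈ Icc 0 (G.len e)) : HasDerivWithinAt (component f e) (increment f e / G.len e)
      (Icc 0 (G.len e)) t := by
  have h1 : HasDerivWithinAt (fun t => f (G.vtx (G.src e)) + t * (increment f e / G.len e))
      (increment f e / G.len e) (Icc 0 (G.len e)) t := by
    simpa using ((hasDerivWithinAt_id t (Icc 0 (G.len e))).mul_const
      (increment f e / G.len e)).const_add (f (G.vtx (G.src e)))
  exact h1.congr (fun s hs => ha e s hs) (ha e t ht)

theorem derivSrc_eq {f : G.Compl → ℝ} (ha : EdgeAffine f) (e : E) :
    derivSrc f e = increment f e / G.len e :=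
  (hasDerivWithinAt_component ha e (zero_mem_Icc e)).derivWithin
    (uniqueDiffOn_Icc (G.len_pos e) _ (zero_mem_Icc e))

theorem derivTgt_eq {f : G.Compl → ℝ} (ha : EdgeAffine f) (e : E) :
    derivTgt f e = -(increment f e / G.len e) := by
  rw [derivTgt, (hasDerivWithinAt_component ha e (len_mem_Icc e)).derivWithin
    (uniqueDiffOn_Icc (G.len_pos e) _ (len_mem_Icc e))]

/-- Used for `src` and for `tgt`: the weights put both sums over the same finite set, and a loop at
`v` is counted once in each. -/
theorem finsum_mem_eq_sum_star (v : V) (g : E → ℝ) (a : E → V)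
    (hsub : ∀ e, a e = v → e ∈ G.star v) :
    ∑ᶠ e ∈ {e | a e = v}, g e = ∑ e ∈ G.star v, hat v (a e) * g e := by
  classical
  have hfin : {e | a e = v}.Finite := (G.star v).finite_toSet.subset hsub
  rw [finsum_mem_eq_finite_toFinset_sum _ hfin]
  have : ∀ e, hat v (a e) * g e = if a e = v then g e else 0 := fun e => by
    simp [hat]
  simp only [this]
  rw [← Finset.sum_filter]
  refine Finset.sum_congr ?_ fun _ _ => rfl
  ext e
  simpa using hsub e

theorem vertex_condition_iff {f : G.Compl → ℝ} (ha : EdgeAffine f) (v : V) :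
    (∑ᶠ e ∈ {e | G.src e = v}, derivSrc f e) + (∑ᶠ e ∈ {e | G.tgt e = v}, derivTgt f e) = 0 ↔
      Kirchhoff f v := by
  rw [finsum_mem_eq_sum_star v _ _ (fun e he => mem_star.2 (Or.inl he)),
    finsum_mem_eq_sum_star v _ _ (fun e he => mem_star.2 (Or.inr he)), ← Finset.sum_add_distrib,
    Kirchhoff, ← neg_eq_zero, ← Finset.sum_neg_distrib]
  refine Eq.congr (Finset.sum_congr rfl fun e _ => ?_) rfl
  rw [derivSrc_eq ha, derivTgt_eq ha]
  ring

/-- Apart from continuity, harmonicity becomes a family of linear relations, each between finitely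
many values of `f`. Such relations pass to linear combinations and pointwise limits. -/
theorem isHarmonic_iff {f : G.Compl → ℝ} :
    IsHarmonic f ↔ Continuous f ∧ EdgeAffine f ∧ ∀ v ∉ G.bdry, Kirchhoff f v := by
  constructor
  · intro h
    have ha : EdgeAffine f := by
      intro e t ht
      have := affine_of_second_deriv_eq_zero (G.len_pos e) (h.contDiffOn e) (h.second_deriv e) t ht
      simpa only [component, pt_zero, pt_len, vtx, increment] using this
    exact ⟨h.continuous, ha, fun v hv => (vertex_condition_iff ha v).1 (h.vertex_condition v hv)⟩
  · rintro ⟨hc, ha, hk⟩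
    refine ⟨hc, fun e => ?_, fun e t ht => ?_, fun v hv => (vertex_condition_iff ha v).2 (hk v hv)⟩
    · have : ContDiffOn ℝ 2 (fun t => f (G.vtx (G.src e)) + t * (increment f e / G.len e))
          (Icc 0 (G.len e)) := by fun_prop
      exact this.congr fun t ht => ha e t ht
    · have huniq := uniqueDiffOn_Icc (G.len_pos e)
      rw [iteratedDerivWithin_succ]
      have h1 : derivWithin (iteratedDerivWithin 1 (component f e) (Icc 0 (G.len e)))
          (Icc 0 (G.len e)) t = derivWithin (fun _ => increment f e / G.len e)
          (Icc 0 (G.len e)) t := by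
        have h2 : ∀ s ∈ Icc 0 (G.len e), iteratedDerivWithin 1 (component f e) (Icc 0 (G.len e)) s
            = increment f e / G.len e := fun s hs => by
          rw [iteratedDerivWithin_one]
          exact (hasDerivWithinAt_component ha e hs).derivWithin (huniq s hs)
        exact derivWithin_congr h2 (h2 t ht)
      rw [h1]
      simp

theorem energy_lt_top_of_memH1 {f : G.Compl → ℝ} (ha : EdgeAffine f) (h : MemH1 f) :
    energy f < ⊤ := by
  convert h.finite_energy using 1
  refine tsum_congr fun e => ?_
  have hlen := G.len_pos e
  have h1 : ∀ t ∈ Ioo 0 (G.len e), ENNReal.ofReal (deriv (component f e) t ^ 2) =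
      ENNReal.ofReal ((increment f e / G.len e) ^ 2) := by
    intro t ht
    rw [((hasDerivWithinAt_component ha e (Ioo_subset_Icc_self ht)).hasDerivAt
      (Icc_mem_nhds ht.1 ht.2)).deriv]
  rw [setLIntegral_congr_fun measurableSet_Ioo h1, setLIntegral_const, Real.volume_Ioo, sub_zero,
    ← ENNReal.ofReal_mul (sq_nonneg _)]
  congr 1
  field_simp

/-! ### The maximum principle -/

/-- Each summand of the vertex condition is the drop from `v` to the other end of the edge, divided
by the length. At a maximum these are nonnegative with sum zero, so all vanish. -/
theorem eq_of_kirchhoff_of_le {f : G.Compl → ℝ} {v : V} (hk : Kirchhoff f v)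
    (hmax : ∀ w, f (G.vtx w) ≤ f (G.vtx v)) {e : E} (he : e ∈ G.star v) :
    f (G.vtx (G.src e)) = f (G.vtx (G.tgt e)) := by
  have hterm : ∀ e ∈ G.star v,
      0 ≤ (hat v (G.tgt e) - hat v (G.src e)) * (increment f e / G.len e) := by
    intro e _
    rw [mul_div_assoc']
    refine div_nonneg ?_ (G.len_pos e).le
    rw [increment]
    by_cases h1 : G.src e = v <;> by_cases h2 : G.tgt e = v
    · simp [h1, h2]
    · rw [h1, hat_self, hat_of_ne h2]
      linarith [hmax (G.tgt e)]
    · rw [h2, hat_self, hat_of_ne h1]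
      linarith [hmax (G.src e)]
    · rw [hat_of_ne h1, hat_of_ne h2]; simp
  have h0 := (Finset.sum_eq_zero_iff_of_nonneg hterm).1 hk e he
  rcases mul_eq_zero.1 h0 with h | h
  · by_cases h1 : G.src e = v <;> by_cases h2 : G.tgt e = v
    · rw [h1, h2]
    · rw [h1, hat_self, hat_of_ne h2] at h
      norm_num at h
    · rw [h2, hat_self, hat_of_ne h1] at h
      norm_num at h
    · exact absurd (mem_star.1 he) (by tauto)
  · rcases div_eq_zero_iff.1 h with h | h
    · exact (sub_eq_zero.1 h).symm
    · exact absurd h (G.len_pos e).ne'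

/-- A maximum exceeding `M` is attained at an interior point of the graph. It propagates to all
vertices by connectedness, then to all edges, and by density to the boundary point `b`, a
contradiction. -/
theorem IsHarmonic.le_of_le_boundary [CompactSpace G.Compl] {f : G.Compl → ℝ} (hf : IsHarmonic f)
    {M : ℝ} (hne : G.boundary.Nonempty) (hM : ∀ x ∈ G.boundary, f x ≤ M) (x : G.Compl) :
    f x ≤ M := by
  obtain ⟨hc, ha, hk⟩ := isHarmonic_iff.1 hf
  obtain ⟨b, hb⟩ := hne
  obtain ⟨z, -, hz⟩ := isCompact_univ.exists_isMaxOn ⟨b, mem_univ b⟩ hc.continuousOn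
  replace hz : ∀ y, f y ≤ f z := fun y => hz (mem_univ y)
  refine (hz x).trans (le_of_not_gt fun hgt => ?_)
  have hstep : ∀ e, f (G.vtx (G.src e)) = f z ∨ f (G.vtx (G.tgt e)) = f z →
      f (G.vtx (G.src e)) = f (G.vtx (G.tgt e)) := by
    have hv : ∀ v, f (G.vtx v) = f z → ∀ e ∈ G.star v,
        f (G.vtx (G.src e)) = f (G.vtx (G.tgt e)) := by
      intro v hv e he
      have hvb : v ∉ G.bdry := fun h => absurd (hM _ (vtx_mem_boundary h)) (by linarith)
      exact eq_of_kirchhoff_of_le (hk v hvb) (fun w => (hz _).trans_eq hv.symm) he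
    rintro e (h | h)
    · exact hv _ h e (mem_star.2 (Or.inl rfl))
    · exact hv _ h e (mem_star.2 (Or.inr rfl))
  have hprop : ∀ v w, f (G.vtx v) = f z ↔ f (G.vtx w) = f z := by
    intro v w
    induction G.connected v w with
    | rel a b h =>
      obtain ⟨e, rfl, rfl⟩ := h
      exact ⟨fun h => (hstep e (Or.inl h)).symm.trans h, fun h => (hstep e (Or.inr h)).trans h⟩
    | refl a => exact Iff.rfl
    | symm a b _ ih => exact ih.symm
    | trans a b c _ _ ih1 ih2 => exact ih1.trans ih2
  have hex : ∃ v, f (G.vtx v) = f z := by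
    obtain ⟨p, -, hp⟩ := exists_of_notMem_boundary
      (fun h => absurd (hM z h) (not_le.2 hgt) : z ∉ G.boundary)
    cases p with
    | vertex v => exact ⟨v, congrArg f hp⟩
    -- An affine function with a maximum inside an edge takes that maximum at the endpoint `src e`
    -- too.
    | inner e t ht =>
      refine ⟨G.src e, le_antisymm (hz _) ?_⟩
      have h1 := ha e t (Ioo_subset_Icc_self ht)
      rw [pt_inner G e t ht, hp] at h1
      have h2 := hz (G.vtx (G.tgt e))
      have h3 : f (G.vtx (G.tgt e)) = f (G.vtx (G.src e)) + increment f e := by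
        rw [increment]; ring
      have hlen := G.len_pos e
      have h4 : t / G.len e < 1 := (div_lt_one hlen).2 ht.2
      have h5 : t * (increment f e / G.len e) = t / G.len e * increment f e := by ring
      have h6 : 0 < t / G.len e := div_pos ht.1 hlen
      have h7 : increment f e ≤ 0 := by
        by_contra hn
        nlinarith
      nlinarith
  obtain ⟨v, hv⟩ := hex
  have hall : ∀ w, f (G.vtx w) = f z := fun w => (hprop v w).1 hv
  have hconst : ∀ p : G.Point, f p = f z := by
    intro p
    cases p with
    | vertex w => exact hall w
    | inner e t ht =>
      have h1 := ha e t (Ioo_subset_Icc_self ht)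
      rw [pt_inner G e t ht, increment, hall, hall] at h1
      simpa using h1
  have hbz : f b = f z := UniformSpace.Completion.induction_on b
    (isClosed_eq hc continuous_const) hconst
  linarith [hM b hb]

/-! ### Boundary indicator functions have extensions of finite energy -/

theorem energy_lt_top_of_finite {f : G.Compl → ℝ} (h : {e | increment f e ≠ 0}.Finite) :
    energy f < ⊤ := by
  rw [energy, tsum_eq_sum (s := h.toFinset) fun e he => by
    have : increment f e = 0 := by simpa using he
    simp [this]]
  exact ENNReal.sum_lt_top.2 fun e _ => ENNReal.ofReal_lt_top

/-- A Urysohn function `χ` takes values in `[1/3, 2/3]` only on a compact set off the boundary,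
hence on finitely many edges. Truncating `χ` at these levels gives `ψ`, constant on every other
edge. Interpolating `ψ` from the vertices leaves finitely many nonzero increments. -/
theorem exists_edgeAffine_indicator [CompactSpace G.Compl] {A B : Set G.Compl} (hA : IsClosed A)
    (hB : IsClosed B) (hAB : Disjoint A B) (hbd : G.boundary = A ∪ B) :
    ∃ φ : G.Compl → ℝ, Continuous φ ∧ EdgeAffine φ ∧ energy φ < ⊤ ∧ (∀ x ∈ A, φ x = 1) ∧
      ∀ x ∈ B, φ x = 0 := by
  obtain ⟨χ, hχB, hχA, -⟩ := exists_continuous_zero_one_of_isClosed hB hA hAB.symm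
  have hK : IsCompact (χ ⁻¹' Icc (1 / 3) (2 / 3)) := (isClosed_Icc.preimage χ.continuous).isCompact
  obtain ⟨S, hS⟩ := exists_finset_edges hK (by
    rw [hbd, disjoint_right]
    rintro x (hx | hx) ⟨h1, h2⟩
    · rw [hχA hx] at h2
      norm_num at h2
    · rw [hχB hx] at h1
      norm_num at h1)
  set ψ : G.Compl → ℝ := fun x => max 0 (min 1 (3 * χ x - 1)) with hψ
  have hψc : Continuous ψ := by fun_prop
  have hlow : ∀ x, χ x < 1 / 3 → ψ x = 0 := fun x hx =>
    max_eq_left ((min_le_right _ _).trans (by linarith))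
  have hhigh : ∀ x, 2 / 3 < χ x → ψ x = 1 := fun x hx => by
    rw [hψ]
    dsimp only
    rw [min_eq_left (by linarith), max_eq_right zero_le_one]
  have hconst : ∀ e ∉ S, ∀ s ∈ Icc 0 (G.len e), ∀ t ∈ Icc 0 (G.len e),
      ψ (G.pt e s) = ψ (G.pt e t) := by
    intro e he
    have hcont : ContinuousOn (fun t => χ (G.pt e t)) (Icc 0 (G.len e)) :=
      (χ.continuous.comp (UniformSpace.Completion.continuous_coe _)).comp_continuousOn
        (continuousOn_pt e)
    have hlh : ∀ r ∈ Icc 0 (G.len e), χ (G.pt e r) < 1 / 3 ∨ 2 / 3 < χ (G.pt e r) := by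
      intro r hr
      by_contra! h
      exact hS e he r hr h
    have hno : ∀ s ∈ Icc 0 (G.len e), ∀ t ∈ Icc 0 (G.len e), χ (G.pt e s) < 1 / 3 →
        ¬ 2 / 3 < χ (G.pt e t) := by
      intro s hs t ht h1 h2
      obtain ⟨r, hr, hr2⟩ := isPreconnected_Icc.intermediate_value hs ht hcont
        (show (1 / 2 : ℝ) ∈ Icc (χ (G.pt e s)) (χ (G.pt e t)) from
          ⟨by linarith, by linarith⟩)
      simp only at hr2
      rcases hlh r hr with h | h <;> linarith
    intro s hs t ht
    rcases hlh s hs with h1 | h1 <;> rcases hlh t ht with h2 | h2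
    · rw [hlow _ h1, hlow _ h2]
    · exact absurd h2 (hno s hs t ht h1)
    · exact absurd h1 (hno t ht s hs h2)
    · rw [hhigh _ h1, hhigh _ h2]
  have hends : ∀ e ∉ S, ψ (G.vtx (G.tgt e)) = ψ (G.vtx (G.src e)) := by
    intro e he
    have := hconst e he _ (len_mem_Icc e) _ (zero_mem_Icc e)
    rwa [pt_zero, pt_len] at this
  have hfin : {e | ψ (G.vtx (G.tgt e)) ≠ ψ (G.vtx (G.src e))}.Finite :=
    S.finite_toSet.subset fun e he => by
      by_contra hn
      exact he (hends e hn)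
  obtain ⟨φ, hφc, hφa, hφv, -⟩ := exists_edgeAffine (G := G) (fun v => ψ (G.vtx v)) hfin
  have hφψ : ∀ x ∈ G.boundary, φ x = ψ x := by
    intro x hx
    by_contra hne
    -- `φ` and `ψ` agree on the graph off the compact union of the edges in `S`, so they can differ
    -- only at points of the graph; vertices are excluded by `hφv`, inner points by not being in the
    -- boundary.
    obtain ⟨p, -, rfl⟩ := mem_image_of_ne_zero (f := fun x => φ x - ψ x) (hφc.sub hψc)
      (S.isCompact_biUnion fun e _ => isCompact_edge (G := G) e) (fun p hp => by
        cases p with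
        | vertex v => exact absurd (sub_eq_zero.2 (hφv v)) hp
        | inner e t ht =>
          have ht' := Ioo_subset_Icc_self ht
          refine mem_biUnion (x := e) ?_ ⟨t, ht', pt_inner G e t ht⟩
          by_contra he
          refine hp ?_
          have h1 := hφa e t ht'
          have h2 := hconst e he t ht' 0 (zero_mem_Icc e)
          rw [increment, hφv, hφv, hends e he, sub_self, zero_div, mul_zero, add_zero] at h1
          rw [pt_zero] at h2
          rw [← pt_inner G e t ht, h1, h2, vtx, sub_self]) (sub_ne_zero.2 hne)
    cases p with
    | vertex w => exact hne (hφv w)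
    | inner e t ht => exact notMem_boundary (inner_mem_interior e t ht) hx
  refine ⟨φ, hφc, hφa, energy_lt_top_of_finite (hfin.subset fun e he h => he ?_), ?_, ?_⟩
  · rw [increment, hφv, hφv, h, sub_self]
  · intro x hx
    rw [hφψ x (hbd ▸ Or.inl hx)]
    exact hhigh x (by rw [hχA hx]; norm_num)
  · intro x hx
    rw [hφψ x (hbd ▸ Or.inr hx)]
    exact hlow x (by rw [hχB hx]; norm_num)

/-! ### Minimisation of the energy -/

theorem lowerSemicontinuous_energy : LowerSemicontinuous (energy (G := G)) := by
  refine lowerSemicontinuous_tsum fun e => Continuous.lowerSemicontinuous ?_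
  unfold increment
  exact ENNReal.continuous_ofReal.comp (by fun_prop)

/-- The competitors in the minimisation of the energy: functions with prescribed boundary values,
of energy at most `C`, with the modulus of continuity that comes with that bound. -/
def competitors (φ : G.Compl → ℝ) (C : ℝ) : Set (G.Compl → ℝ) :=
  {u | (∀ x ∈ G.boundary, u x = φ x) ∧ EdgeAffine u ∧ energy u ≤ ENNReal.ofReal C ∧
    ∀ l > 0, ∀ x y, |u x - u y| ≤ l * dist x y + C / l}

/-- The topology is that of pointwise convergence. Continuity would not be a closed condition, but a
fixed modulus of continuity is. -/
theorem isClosed_competitors (φ : G.Compl → ℝ) (C : ℝ) : IsClosed (competitors φ C) := by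
  have h1 : IsClosed {u : G.Compl → ℝ | ∀ x ∈ G.boundary, u x = φ x} := by
    simp only [ofPred_forall]
    exact isClosed_iInter fun x => isClosed_iInter fun _ => isClosed_eq (by fun_prop) (by fun_prop)
  have h2 : IsClosed {u : G.Compl → ℝ | EdgeAffine u} := by
    unfold EdgeAffine increment
    simp only [ofPred_forall]
    exact isClosed_iInter fun e => isClosed_iInter fun t => isClosed_iInter fun _ =>
      isClosed_eq (by fun_prop) (by fun_prop)
  have h3 : IsClosed {u : G.Compl → ℝ | energy u ≤ ENNReal.ofReal C} :=
    lowerSemicontinuous_energy.isClosed_preimage _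
  have h4 : IsClosed {u : G.Compl → ℝ | ∀ l > 0, ∀ x y, |u x - u y| ≤ l * dist x y + C / l} := by
    simp only [ofPred_forall]
    exact isClosed_iInter fun l => isClosed_iInter fun _ => isClosed_iInter fun x =>
      isClosed_iInter fun y => isClosed_le (by fun_prop) (by fun_prop)
  exact h1.inter (h2.inter (h3.inter h4))

/-- Tychonoff: the modulus with `l = 1`, together with the prescribed value at one boundary point
`b`, bounds each value `u x`. -/
theorem isCompact_competitors (hne : G.boundary.Nonempty) (φ : G.Compl → ℝ) (C : ℝ) :
    IsCompact (competitors φ C) := by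
  obtain ⟨b, hb⟩ := hne
  refine (isCompact_univ_pi (s := fun x => Icc (φ b - (dist x b + C)) (φ b + (dist x b + C)))
    fun x => isCompact_Icc).of_isClosed_subset (isClosed_competitors φ C) ?_
  rintro u ⟨h1, -, -, h4⟩ x -
  have := abs_le.1 (h4 1 one_pos x b)
  rw [h1 b hb, one_mul, div_one] at this
  exact ⟨by linarith [this.1], by linarith [this.2]⟩

theorem continuous_of_mem_competitors {φ u : G.Compl → ℝ} {C : ℝ} (hC : 0 < C)
    (hu : u ∈ competitors φ C) : Continuous u := by
  rw [Metric.continuous_iff]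
  intro x ε hε
  obtain ⟨-, -, -, h⟩ := hu
  have hl : 0 < 2 * C / ε := by positivity
  refine ⟨ε / 2 / (2 * C / ε), by positivity, fun y hy => ?_⟩
  have h1 := h _ hl y x
  rw [lt_div_iff₀ hl, mul_comm] at hy
  have h2 : C / (2 * C / ε) = ε / 2 := by field_simp
  rw [Real.dist_eq]
  linarith

theorem increment_add_smul (f h : G.Compl → ℝ) (r : ℝ) (e : E) :
    increment (fun x => f x + r * h x) e = increment f e + r * increment h e := by
  simp only [increment]
  ring

theorem EdgeAffine.add_smul {f h : G.Compl → ℝ} (hf : EdgeAffine f) (hh : EdgeAffine h) (r : ℝ) :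
    EdgeAffine fun x => f x + r * h x := by
  intro e t ht
  simp only [increment_add_smul, hf e t ht, hh e t ht]
  ring

theorem eq_zero_of_forall_quadratic {a b : ℝ} (h : ∀ r : ℝ, 0 ≤ 2 * r * a + r ^ 2 * b) : a = 0 := by
  have hb : 0 ≤ b := by linarith [h 1, h (-1)]
  by_contra ha
  -- The minimiser would be `-a / b`; the shift by one covers `b = 0`.
  have h1 := h (-a / (b + 1))
  have h2 : 2 * (-a / (b + 1)) * a + (-a / (b + 1)) ^ 2 * b =
      -(a ^ 2 * (b + 2)) / (b + 1) ^ 2 := by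
    field_simp
    ring
  rw [h2] at h1
  have h3 : 0 < a ^ 2 * (b + 2) / (b + 1) ^ 2 := by positivity
  rw [neg_div] at h1
  linarith

/-- The first variation of the energy in the direction of a hat function. -/
theorem kirchhoff_of_energy_le {u h : G.Compl → ℝ} {v : V} (hu : energy u < ⊤)
    (hh : ∀ w, h (G.vtx w) = hat v w)
    (hmin : ∀ r : ℝ, energy u ≤ energy fun x => u x + r * h x) : Kirchhoff u v := by
  have hinc : ∀ e, increment h e = hat v (G.tgt e) - hat v (G.src e) := fun e => by
    rw [increment, hh, hh]
  have hfin : ∀ r : ℝ, ∑ e ∈ G.star v, increment u e ^ 2 / G.len e ≤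
      ∑ e ∈ G.star v, (increment u e + r * increment h e) ^ 2 / G.len e := by
    intro r
    have h1 := hmin r
    have hu' := hu.ne
    rw [energy, ← ENNReal.sum_add_tsum_compl (G.star v)] at h1 hu'
    rw [energy, ← ENNReal.sum_add_tsum_compl (G.star v)] at h1
    simp only [increment_add_smul] at h1
    -- The perturbation leaves the increments off `star v` unchanged; this common tail is finite and
    -- cancels.
    have h2 : ∑' e : ↥((G.star v : Set E)ᶜ),
        ENNReal.ofReal ((increment u e + r * increment h e) ^ 2 / G.len e) =
        ∑' e : ↥((G.star v : Set E)ᶜ), ENNReal.ofReal (increment u e ^ 2 / G.len e) := by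
      refine tsum_congr fun e => ?_
      obtain ⟨h3, h4⟩ := hat_tgt_eq_of_notMem_star (G := G) (v := v) (e := e.1) e.2
      rw [hinc, h3, h4]
      simp
    rw [h2] at h1
    have h3 := (ENNReal.add_le_add_iff_right (ENNReal.add_ne_top.1 hu').2).1 h1
    rw [← ENNReal.ofReal_sum_of_nonneg fun e _ => div_nonneg (sq_nonneg _) (G.len_pos e).le,
      ← ENNReal.ofReal_sum_of_nonneg fun e _ => div_nonneg (sq_nonneg _) (G.len_pos e).le] at h3
    exact (ENNReal.ofReal_le_ofReal_iff
      (Finset.sum_nonneg fun e _ => div_nonneg (sq_nonneg _) (G.len_pos e).le)).1 h3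
  refine eq_zero_of_forall_quadratic (b := ∑ e ∈ G.star v, increment h e ^ 2 / G.len e)
    fun r => ?_
  have h1 := sub_nonneg.2 (hfin r)
  rw [← Finset.sum_sub_distrib] at h1
  rw [Finset.mul_sum, Finset.mul_sum, ← Finset.sum_add_distrib]
  refine h1.trans_eq (Finset.sum_congr rfl fun e _ => ?_)
  rw [← hinc]
  ring

/-- The boundary values of a continuous function of finite energy have a harmonic extension. -/
theorem exists_isHarmonic [Countable E] (hne : G.boundary.Nonempty) {φ : G.Compl → ℝ}
    (hc : Continuous φ) (ha : EdgeAffine φ) (hE : energy φ < ⊤) :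
    ∃ u : G.Compl → ℝ, IsHarmonic u ∧ ∀ x ∈ G.boundary, u x = φ x := by
  -- The added one keeps `C` positive when the energy of `φ` is zero.
  set C : ℝ := (energy φ).toReal + 1
  have hC : 0 < C := by positivity
  have hφC : energy φ ≤ ENNReal.ofReal C :=
    ENNReal.le_ofReal_iff_toReal_le hE.ne hC.le |>.2 (by linarith)
  have hφ : φ ∈ competitors φ C :=
    ⟨fun _ _ => rfl, ha, hφC, fun l hl => abs_sub_le_of_energy_le hc ha hC hφC hl⟩
  obtain ⟨u, hu, hmin⟩ := (lowerSemicontinuous_energy.lowerSemicontinuousOn _).exists_isMinOn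
    ⟨φ, hφ⟩ (isCompact_competitors hne φ C)
  have huc := continuous_of_mem_competitors hC hu
  have hutop : energy u < ⊤ := hu.2.2.1.trans_lt ENNReal.ofReal_lt_top
  refine ⟨u, isHarmonic_iff.2 ⟨huc, hu.2.1, fun v hv => ?_⟩, hu.1⟩
  obtain ⟨h, hhc, hha, hhv, hhb⟩ := exists_hat (G := G) v hv
  refine kirchhoff_of_energy_le hutop hhv fun r => ?_
  -- A perturbation of smaller energy is itself a competitor: the energy bound implies the required
  -- modulus of continuity, so that constraint never obstructs the variation.
  by_contra! hlt
  have hle : energy (fun x => u x + r * h x) ≤ ENNReal.ofReal C := hlt.le.trans hu.2.2.1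
  have haff := hu.2.1.add_smul hha r
  have hmem : (fun x => u x + r * h x) ∈ competitors φ C :=
    ⟨fun x hx => by simp only [hhb x hx, mul_zero, add_zero, hu.1 x hx], haff, hle,
      fun l hl => abs_sub_le_of_energy_le (by fun_prop) haff hC hle hl⟩
  exact absurd (hmin hmem) (not_le.2 hlt)

/-! ### Linear combinations and series of harmonic functions -/

theorem IsHarmonic.add_smul {f h : G.Compl → ℝ} (hf : IsHarmonic f) (hh : IsHarmonic h) (r : ℝ) :
    IsHarmonic fun x => f x + r * h x := by
  obtain ⟨hfc, hfa, hfk⟩ := isHarmonic_iff.1 hf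
  obtain ⟨hhc, hha, hhk⟩ := isHarmonic_iff.1 hh
  refine isHarmonic_iff.2 ⟨by fun_prop, hfa.add_smul hha r, fun v hv => ?_⟩
  have h1 := hfk v hv
  have h2 := hhk v hv
  rw [Kirchhoff] at h1 h2 ⊢
  calc _ = ∑ e ∈ G.star v, ((hat v (G.tgt e) - hat v (G.src e)) * (increment f e / G.len e) +
        r * ((hat v (G.tgt e) - hat v (G.src e)) * (increment h e / G.len e))) := by
        refine Finset.sum_congr rfl fun e _ => ?_
        rw [increment_add_smul]
        ring
    _ = 0 := by rw [Finset.sum_add_distrib, ← Finset.mul_sum, h1, h2, mul_zero, add_zero]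

theorem IsHarmonic.ge_of_ge_boundary [CompactSpace G.Compl] {f : G.Compl → ℝ} (hf : IsHarmonic f)
    {m : ℝ} (hne : G.boundary.Nonempty) (hm : ∀ x ∈ G.boundary, m ≤ f x) (x : G.Compl) :
    m ≤ f x := by
  have := (hf.add_smul hf (-2)).le_of_le_boundary (M := -m) hne
    (fun y hy => by linarith [hm y hy]) x
  linarith

theorem IsHarmonic.eq_of_eq_boundary [CompactSpace G.Compl] {f g : G.Compl → ℝ} (hf : IsHarmonic f)
    (hg : IsHarmonic g) (hne : G.boundary.Nonempty) (h : ∀ x ∈ G.boundary, f x = g x) : f = g := by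
  ext x
  have hd := hf.add_smul hg (-1)
  have h1 := hd.le_of_le_boundary (M := 0) hne (fun y hy => by linarith [h y hy]) x
  have h2 := hd.ge_of_ge_boundary (m := 0) hne (fun y hy => by linarith [h y hy]) x
  linarith

/-- Domination by `c` gives continuity of the sum; the affine and vertex relations involve finitely
many values and are summed term by term. -/
theorem isHarmonic_tsum {h : ℕ → G.Compl → ℝ} {c : ℕ → ℝ} (hh : ∀ k, IsHarmonic (h k))
    (hc : Summable c) (hb : ∀ k x, |h k x| ≤ c k) : IsHarmonic fun x => ∑' k, h k x := by
  have hs : ∀ x, Summable fun k => h k x := fun x => hc.of_norm_bounded fun k => hb k x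
  have hinc : ∀ e, HasSum (fun k => increment (h k) e) (increment (fun x => ∑' k, h k x) e) :=
    fun e => (hs _).hasSum.sub (hs _).hasSum
  refine isHarmonic_iff.2 ⟨continuous_tsum (fun k => (hh k).continuous) hc hb, fun e t ht => ?_,
    fun v hv => ?_⟩
  · refine HasSum.tsum_eq (HasSum.congr_fun ?_ fun k => (isHarmonic_iff.1 (hh k)).2.1 e t ht)
    exact (hs _).hasSum.add (((hinc e).div_const _).mul_left t)
  · have h1 : HasSum (fun k => ∑ e ∈ G.star v,
        (hat v (G.tgt e) - hat v (G.src e)) * (increment (h k) e / G.len e))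
        (∑ e ∈ G.star v, (hat v (G.tgt e) - hat v (G.src e)) *
          (increment (fun x => ∑' k, h k x) e / G.len e)) :=
      hasSum_sum fun e _ => ((hinc e).div_const _).mul_left _
    have h2 : (fun k => ∑ e ∈ G.star v,
        (hat v (G.tgt e) - hat v (G.src e)) * (increment (h k) e / G.len e)) = fun _ => 0 :=
      funext fun k => (isHarmonic_iff.1 (hh k)).2.2 v hv
    rw [h2] at h1
    exact h1.unique hasSum_zero

/-- Two boundary points are separated by a harmonic function with boundary values `0` and `1`. -/
theorem exists_isHarmonic_separating [Countable E] [CompactSpace G.Compl]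
    (hdisc : IsTotallyDisconnected G.boundary) {x y : G.Compl} (hx : x ∈ G.boundary)
    (hy : y ∈ G.boundary) (hxy : x ≠ y) :
    ∃ h : G.Compl → ℝ, IsHarmonic h ∧ (∀ z, h z ∈ Icc 0 1) ∧ h x = 1 ∧ h y = 0 := by
  have hcpt : CompactSpace G.boundary :=
    isCompact_iff_compactSpace.1 (isClosed_boundary (G := G)).isCompact
  have htd : TotallyDisconnectedSpace G.boundary := totallyDisconnectedSpace_subtype_iff.2 hdisc
  -- The boundary is compact Hausdorff and totally disconnected, so clopen sets separate its points.
  obtain ⟨U, hU, hxU, hyU⟩ := exists_isClopen_of_totally_separated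
    (show (⟨x, hx⟩ : G.boundary) ≠ ⟨y, hy⟩ from fun h => hxy (congrArg Subtype.val h))
  have hemb := (isClosed_boundary (G := G)).isClosedEmbedding_subtypeVal
  have hcover : G.boundary = Subtype.val '' U ∪ Subtype.val '' Uᶜ := by
    rw [← image_union, union_compl_self, image_univ, Subtype.range_coe]
  obtain ⟨φ, hc, ha, hE, h1, h0⟩ := exists_edgeAffine_indicator (hemb.isClosedMap U hU.isClosed)
    (hemb.isClosedMap Uᶜ hU.compl.isClosed)
    ((disjoint_image_iff Subtype.val_injective).2 disjoint_compl_right) hcover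
  obtain ⟨h, hh, hb⟩ := exists_isHarmonic ⟨x, hx⟩ hc ha hE
  have hmem : ∀ z ∈ G.boundary, h z ∈ Icc (0 : ℝ) 1 := by
    intro z hz
    rw [hb z hz]
    rw [hcover] at hz
    rcases hz with hz | hz
    · rw [h1 z hz]; simp
    · rw [h0 z hz]; simp
  refine ⟨h, hh, fun z => ⟨hh.ge_of_ge_boundary ⟨x, hx⟩ (fun z hz => (hmem z hz).1) z,
    hh.le_of_le_boundary ⟨x, hx⟩ (fun z hz => (hmem z hz).2) z⟩, ?_, ?_⟩
  · rw [hb x hx, h1 x ⟨_, hxU, rfl⟩]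
  · rw [hb y hy, h0 y ⟨_, hyU, rfl⟩]

/-- A function which oscillates by `2 ^ (-k)` between points at distance at most `16 ^ (-k)`, for
each `k`, does not have finite energy. -/
theorem not_memH1_of_oscillation [Countable E] {f : G.Compl → ℝ} (hf : IsHarmonic f) {x : G.Compl}
    {y : ℕ → G.Compl} (hd : ∀ k, dist x (y k) ≤ (1 / 16) ^ k)
    (hosc : ∀ k, (1 / 2 : ℝ) ^ k ≤ f x - f (y k)) : ¬ MemH1 f := by
  intro hH
  obtain ⟨hc, ha, -⟩ := isHarmonic_iff.1 hf
  have hE := energy_lt_top_of_memH1 ha hH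
  set C : ℝ := (energy f).toReal + 1
  have hC : 0 < C := by positivity
  have hfC : energy f ≤ ENNReal.ofReal C :=
    ENNReal.le_ofReal_iff_toReal_le hE.ne hC.le |>.2 (by linarith)
  have hbound : ∀ k : ℕ, (2 : ℝ) ^ k ≤ 1 + C := by
    intro k
    -- With `l = 4 ^ k` both terms of the bound have order `4 ^ (-k)`, against an oscillation of `2
    -- ^ (-k)`.
    have h1 := abs_sub_le_of_energy_le hc ha hC hfC (l := 4 ^ k) (by positivity) x (y k)
    have h2 := (hosc k).trans ((le_abs_self _).trans h1)
    have h3 : (4 : ℝ) ^ k * dist x (y k) ≤ 4 ^ k * (1 / 16) ^ k :=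
      mul_le_mul_of_nonneg_left (hd k) (by positivity)
    have h4 : (4 : ℝ) ^ k * (1 / 16) ^ k = (1 / 4) ^ k := by rw [← mul_pow]; norm_num
    have h5 : C / 4 ^ k = C * (1 / 4) ^ k := by rw [one_div, inv_pow, div_eq_mul_inv]
    have h6 : (1 / 2 : ℝ) ^ k ≤ (1 + C) * (1 / 4) ^ k := by linarith
    have h7 := mul_le_mul_of_nonneg_left h6 (show (0 : ℝ) ≤ 4 ^ k by positivity)
    have h8 : (4 : ℝ) ^ k * (1 / 2) ^ k = 2 ^ k := by rw [← mul_pow]; norm_num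
    have h9 : (4 : ℝ) ^ k * (1 / 4) ^ k = 1 := by rw [← mul_pow]; norm_num
    rw [h8, mul_left_comm, h9, mul_one] at h7
    exact h7
  obtain ⟨k, hk⟩ := pow_unbounded_of_one_lt (1 + C) (one_lt_two (α := ℝ))
  exact absurd (hbound k) (not_le.2 hk)

end MetricGraph

theorem proposition3p7 {V E : Type*} [Countable V] [Countable E] (G : MetricGraph V E)
    (hcompact : CompactSpace G.Compl) (hdisc : IsTotallyDisconnected G.boundary)
    (hlim : ∃ x₀ ∈ G.boundary, AccPt x₀ (𝓟 G.boundary)) :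
    ∃ F : C(G.boundary, ℝ),
      (∃! f : G.Compl → ℝ, MetricGraph.IsHarmonicExtension F f) ∧
      ∀ f : G.Compl → ℝ, MetricGraph.IsHarmonicExtension F f → ¬ MetricGraph.MemH1 f := by
  obtain ⟨x₀, hx₀, hacc⟩ := hlim
  have hnear : ∀ k : ℕ, ∃ y ∈ G.boundary, y ≠ x₀ ∧ dist x₀ y ≤ (1 / 16) ^ k := by
    intro k
    obtain ⟨y, ⟨hy1, hy2⟩, hy3⟩ := accPt_iff_nhds.1 hacc _
      (Metric.ball_mem_nhds x₀ (show (0 : ℝ) < (1 / 16) ^ k by positivity))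
    rw [Metric.mem_ball, dist_comm] at hy1
    exact ⟨y, hy2, hy3, hy1.le⟩
  choose y hyb hyne hyd using hnear
  choose h hh hmem hx hy using fun k =>
    MetricGraph.exists_isHarmonic_separating hdisc hx₀ (hyb k) (hyne k).symm
  set f : G.Compl → ℝ := fun x => ∑' k, (1 / 2 : ℝ) ^ k * h k x with hf
  have hgeom : Summable fun k : ℕ => (1 / 2 : ℝ) ^ k := summable_geometric_two
  have hle : ∀ k x, |(1 / 2 : ℝ) ^ k * h k x| ≤ (1 / 2) ^ k := by
    intro k x
    rw [abs_of_nonneg (mul_nonneg (by positivity) (hmem k x).1)]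
    exact mul_le_of_le_one_right (by positivity) (hmem k x).2
  have hfh : MetricGraph.IsHarmonic f := by
    refine MetricGraph.isHarmonic_tsum (fun k => ?_) hgeom hle
    -- A scalar multiple is written as `h k + (2 ^ (-k) - 1) * h k`.
    convert (hh k).add_smul (hh k) ((1 / 2) ^ k - 1) using 2
    ring
  have hs : ∀ x, Summable fun k => (1 / 2 : ℝ) ^ k * h k x := fun x =>
    hgeom.of_norm_bounded fun k => hle k x
  have hosc : ∀ k, (1 / 2 : ℝ) ^ k ≤ f x₀ - f (y k) := by
    intro k
    have h1 : f x₀ - f (y k) = ∑' j, ((1 / 2 : ℝ) ^ j * h j x₀ - (1 / 2) ^ j * h j (y k)) :=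
      ((hs x₀).tsum_sub (hs (y k))).symm
    rw [h1]
    -- Every term is nonnegative because `h j x₀ = 1` is the largest possible value; the `k`-th term
    -- alone equals `2 ^ (-k)`.
    have h2 := ((hs x₀).sub (hs (y k))).le_tsum k fun j _ => by
      rw [hx, ← mul_sub]
      exact mul_nonneg (by positivity) (sub_nonneg.2 (hmem j _).2)
    simpa only [hx, hy, mul_one, mul_zero, sub_zero] using h2
  have huniq : ∀ g : G.Compl → ℝ, MetricGraph.IsHarmonic g → (∀ x : G.boundary, g x = f x) →
      g = f := fun g hg hgf =>
    hg.eq_of_eq_boundary hfh ⟨x₀, hx₀⟩ fun x hx => hgf ⟨x, hx⟩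
  refine ⟨⟨fun x => f x, hfh.continuous.comp continuous_subtype_val⟩,
    ⟨f, ⟨hfh, fun _ => rfl⟩, fun g hg => huniq g hg.1 hg.2⟩, fun g hg => ?_⟩
  rw [huniq g hg.1 hg.2]
  exact MetricGraph.not_memH1_of_oscillation hfh hyd hosc
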